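/- Conventions. For a metric space $X$ and $x,y,o\in X$ let $(x\mid y)_o:=\frac12\big(d(o,x)+d(o,y)-d(x,y)\big)$. The space $X$ is *hyperbolic* if there is $\delta\ge 0$ with $(x\mid y)_o\ge\min\{(x\mid z)_o,(z\mid y)_o\}-\delta$ for all $x,y,z,o\in X$ (no geodesicity or properness is assumed). A sequence $(x_i)$ in $X$ *converges to infinity* if $\lim_{i,j\to\infty}(x_i\mid x_j)_o=\infty$; two such sequences are equivalent if $\lim_{i\to\infty}(x_i\mid y_i)_o=\infty$ (both notions are independent of $o$). The Gromov boundary $\partial_\infty X$ of a hyperbolic space $X$ is the set of equivalence classes of sequences converging to infinity. It carries the visual topology, in which a neighbourhood basis of $\xi$ is given by the sets $\{\eta:(\xi\mid\eta)_o>R\}$, $R\ge 0$, where $(\xi\mid\eta)_o:=\inf_{(x_i)\in\xi,\,(y_i)\in\eta}\liminf_{i\to\infty}(x_i\mid y_i)_o$; it does not depend on the base point $o$. Paths are not assumed to be continuous. A path $\gamma\colon[a,\infty)\to X$ *defines* the point $\xi\in\partial_\infty X$, written $[\gamma]=\xi$, if for every nondecreasing sequence $a\le t_1\le t_2\le\dots$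 with $t_i\to\infty$ the sequence $(\gamma(t_i))_i$ converges to infinity and belongs to $\xi$. A path $\gamma\colon I\to X$ on a closed interval $I\subseteq\mathbb R$ is an *unparametrised $D$-quasi-ruler* if $d(\gamma(t),\gamma(s))+d(\gamma(s),\gamma(r))\le d(\gamma(t),\gamma(r))+D$ for all $t<s<r$ in $I$, and $\limsup_{t\to t_0}d(\gamma(t),\gamma(t_0))<D$ for every $t_0\in I$. A metric space *admits a quasi-ruling* if there is $D\ge 0$ such that any two of its points are joined by an unparametrised $D$-quasi-ruler defined on a compact interval. A map $f\colon X\to X'$ is a *quasi-isometry* if there are $K\ge 1$, $C\ge 0$ such that $\frac1K d(x,y)-C\le d(f(x),f(y))\le K d(x,y)+C$ for all $x,y\in X$ and every $x'\in X'$ is at distance at most $C$ from $f(X)$. Statement. Let $f\colon X\to X'$ be a quasi-isometry between metric spaces that both admit a quasi-ruling, and suppose that $X$ is hyperbolic. Then $X'$ is hyperbolic, and $f$ extends naturally to a homeomorphism $\partial f\colon\partial_\infty X\to\partial_\infty X'$; that is, for every sequence $(x_i)$ in $X$ that converges to infinity and represents $\xi\in\partial_\infty X$, the sequence $(f(x_i))$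 converges to infinity and represents $\partial f(\xi)$. Moreover, for every path $\gamma\colon[a,\infty)\to X$ that defines a point of $\partial_\infty X$, the path $f\circ\gamma$ defines a point of $\partial_\infty X'$, and $[f\circ\gamma]=\partial f([\gamma])$. -/

import Mathlib

open Filter Topology Set

/-- `f` is a quasi-isometry: a `(K, C)`-quasi-isometric embedding for some `K ≥ 1`, `C ≥ 0`,
such that every point of the target is at distance at most `C` from the image. -/
def IsQuasiIsometry {X X' : Type*} [MetricSpace X] [MetricSpace X'] (f : X → X') : Prop :=
  ∃ K C : ℝ, 1 ≤ K ∧ 0 ≤ C ∧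
    (∀ x y : X, 1 / K * dist x y - C ≤ dist (f x) (f y) ∧
      dist (f x) (f y) ≤ K * dist x y + C) ∧
    ∀ x' : X', ∃ x : X, dist (f x) x' ≤ C

/-- A (not necessarily continuous) path `γ : I → X` is an unparametrised `D`-quasi-ruler.
The upper limit is taken in `[0, ∞]`, over `t ∈ I` tending to `t₀`. -/
def IsUnparametrisedQuasiRuler {X : Type*} [MetricSpace X] (D : ℝ) {I : Set ℝ} (γ : I → X) :
    Prop :=
  (∀ t s r : I, t < s → s < r →
    dist (γ t) (γ s) + dist (γ s) (γ r) ≤ dist (γ t) (γ r) + D) ∧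
  ∀ t₀ : I, limsup (fun t : I => edist (γ t) (γ t₀)) (𝓝 t₀) < ENNReal.ofReal D

/-- `X` admits a quasi-ruling: for some `D ≥ 0` any two points of `X` are joined by an
unparametrised `D`-quasi-ruler defined on a compact interval. -/
def AdmitsQuasiRuling (X : Type*) [MetricSpace X] : Prop :=
  ∃ D : ℝ, 0 ≤ D ∧ ∀ x y : X, ∃ (a b : ℝ) (hab : a ≤ b) (γ : Icc a b → X),
    IsUnparametrisedQuasiRuler D γ ∧
      γ ⟨a, left_mem_Icc.2 hab⟩ = x ∧ γ ⟨b, right_mem_Icc.2 hab⟩ = y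

/-- The Gromov product `(x | y)_o`. -/
noncomputable def gromovProduct {X : Type*} [MetricSpace X] (o x y : X) : ℝ :=
  (1 / 2) * (dist o x + dist o y - dist x y)

/-- `X` is Gromov hyperbolic, i.e. `δ`-hyperbolic for some `δ ≥ 0`. -/
class IsGromovHyperbolic (X : Type*) [MetricSpace X] : Prop where
  exists_delta : ∃ δ : ℝ, 0 ≤ δ ∧ ∀ x y z o : X,
    min (gromovProduct o x z) (gromovProduct o z y) - δ ≤ gromovProduct o x y

/-- The sequence `x` converges to infinity (for one, equivalently every, base point `o`). -/
def ConvergesToInfinity {X : Type*} [MetricSpace X] (x : ℕ → X) : Prop :=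
  ∀ o : X, Tendsto (fun p : ℕ × ℕ => gromovProduct o (x p.1) (x p.2)) atTop atTop

/-- Two sequences (converging to infinity) are equivalent. -/
def EquivalentAtInfinity {X : Type*} [MetricSpace X] (x y : ℕ → X) : Prop :=
  ∀ o : X, Tendsto (fun i : ℕ => gromovProduct o (x i) (y i)) atTop atTop

theorem gromovProduct_comm {X : Type*} [MetricSpace X] (o x y : X) :
    gromovProduct o x y = gromovProduct o y x := by
  unfold gromovProduct
  rw [dist_comm x y]
  ring

theorem EquivalentAtInfinity.trans {X : Type*} [MetricSpace X] [IsGromovHyperbolic X]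
    {x y z : ℕ → X} (hxy : EquivalentAtInfinity x y) (hyz : EquivalentAtInfinity y z) :
    EquivalentAtInfinity x z := by
  obtain ⟨δ, -, hδ⟩ := IsGromovHyperbolic.exists_delta (X := X)
  intro o
  rw [tendsto_atTop]
  intro b
  filter_upwards [(tendsto_atTop.1 (hxy o)) (b + δ), (tendsto_atTop.1 (hyz o)) (b + δ)]
    with i h1 h2
  have h := hδ (x i) (z i) (y i) o
  have := le_min h1 h2
  linarith

/-- Equivalence of sequences converging to infinity, as a setoid. -/
def boundarySetoid (X : Type*) [MetricSpace X] [IsGromovHyperbolic X] :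
    Setoid {x : ℕ → X // ConvergesToInfinity x} where
  r x y := EquivalentAtInfinity x.1 y.1
  iseqv :=
    { refl := fun x o => (x.2 o).comp tendsto_atTop_diagonal
      symm := fun h o => by simpa only [gromovProduct_comm] using h o
      trans := fun h h' => h.trans h' }

/-- The boundary at infinity (visual boundary, Gromov boundary) of a hyperbolic space, as a
set. -/
def GromovBoundary (X : Type*) [MetricSpace X] [IsGromovHyperbolic X] : Type _ :=
  Quotient (boundarySetoid X)

/-- The boundary point represented by a sequence converging to infinity. -/
def GromovBoundary.mk {X : Type*} [MetricSpace X] [IsGromovHyperbolic X] (x : ℕ → X)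
    (hx : ConvergesToInfinity x) : GromovBoundary X :=
  Quotient.mk (boundarySetoid X) ⟨x, hx⟩

/-- The sequence `x` converges to infinity and belongs to the equivalence class `ξ`. -/
def GromovBoundary.Represents {X : Type*} [MetricSpace X] [IsGromovHyperbolic X] (x : ℕ → X)
    (ξ : GromovBoundary X) : Prop :=
  ∃ hx : ConvergesToInfinity x, GromovBoundary.mk x hx = ξ

/-- The Gromov product `(ξ | η)_o` of boundary points: the infimum, over all representatives,
of the lower limit of `(x i | y i)_o`, with values in the extended reals. -/
noncomputable def boundaryGromovProduct {X : Type*} [MetricSpace X] [IsGromovHyperbolic X]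
    (o : X) (ξ η : GromovBoundary X) : EReal :=
  ⨅ (x : ℕ → X) (y : ℕ → X) (_ : GromovBoundary.Represents x ξ)
    (_ : GromovBoundary.Represents y η),
    liminf (fun i : ℕ => ((gromovProduct o (x i) (y i) : ℝ) : EReal)) atTop

/-- The basic neighbourhood `U_{o,R}(ξ)` of a boundary point. -/
def visualNhd {X : Type*} [MetricSpace X] [IsGromovHyperbolic X] (o : X) (R : ℝ)
    (ξ : GromovBoundary X) : Set (GromovBoundary X) :=
  {η | (R : EReal) < boundaryGromovProduct o ξ η}

theorem visualNhd_anti {X : Type*} [MetricSpace X] [IsGromovHyperbolic X] (o : X) {R S : ℝ}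
    (h : R ≤ S) (ξ : GromovBoundary X) : visualNhd o S ξ ⊆ visualNhd o R ξ :=
  fun _ hη => lt_of_le_of_lt (EReal.coe_le_coe_iff.2 h) hη

/-- The visual topology on the boundary, with base point `o`: the sets `U_{o,R}(ξ)`, `R ≥ 0`,
form a neighbourhood basis of `ξ`. (It does not depend on `o`.) -/
abbrev visualTopology {X : Type*} [MetricSpace X] [IsGromovHyperbolic X] (o : X) :
    TopologicalSpace (GromovBoundary X) where
  IsOpen U := ∀ ξ ∈ U, ∃ R : ℝ, 0 ≤ R ∧ visualNhd o R ξ ⊆ U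
  isOpen_univ := fun _ _ => ⟨0, le_rfl, subset_univ _⟩
  isOpen_inter := by
    rintro U V hU hV ξ ⟨hξU, hξV⟩
    obtain ⟨R, hR, hRU⟩ := hU ξ hξU
    obtain ⟨S, -, hSV⟩ := hV ξ hξV
    exact ⟨max R S, hR.trans (le_max_left _ _),
      subset_inter ((visualNhd_anti o (le_max_left _ _) ξ).trans hRU)
        ((visualNhd_anti o (le_max_right _ _) ξ).trans hSV)⟩
  isOpen_sUnion := by
    intro s hs ξ hξ
    obtain ⟨U, hU, hξU⟩ := hξ
    obtain ⟨R, hR, hRU⟩ := hs U hU ξ hξU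
    exact ⟨R, hR, hRU.trans (subset_sUnion_of_mem hU)⟩

/-- The (not necessarily continuous) path `γ : [a, ∞) → X` defines the boundary point `ξ`,
that is, `[γ] = ξ`. -/
def DefinesBoundaryPoint {X : Type*} [MetricSpace X] [IsGromovHyperbolic X] {a : ℝ}
    (γ : Ici a → X) (ξ : GromovBoundary X) : Prop :=
  ∀ t : ℕ → Ici a, Monotone t → Tendsto (fun i => (t i : ℝ)) atTop atTop →
    GromovBoundary.Represents (γ ∘ t) ξ

/-! Quasi-rulers reparametrise to rough segments, so both spaces are geodesic up to an additive
error. The Morse lemma, `exists_roughSegment_near_quasiGeodesic` and its converse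
`exists_quasiGeodesic_near_roughSegment`, holds without continuity: bisection shows that a detour
avoiding a ball of radius r has length exponential in r, whereas linear length would do at the
farthest point.

In a hyperbolic space the Gromov product is, up to a constant, the distance to a rough segment. The
Morse lemma therefore gives (x|y)_o ≤ K (fx|fy)_{fo} + A for an embedding into a hyperbolic space
(`IsQIEmbedding.exists_gromovProduct_le`). This inequality pulls hyperbolicity back; applied to a
quasi-inverse it makes X' hyperbolic. Used for f and its quasi-inverse, it yields mutually inverse
continuous boundary maps. -/

/-! ### Elementary estimates for Gromov products -/

section GromovProduct

variable {X : Type*} [MetricSpace X]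

theorem gromovProduct_self (o x : X) : gromovProduct o x x = dist o x := by
  simp only [gromovProduct, dist_self]; ring

theorem dist_sub_dist_le_gromovProduct (o x y : X) :
    dist o x - dist x y ≤ gromovProduct o x y := by
  have := dist_triangle o y x
  rw [dist_comm y x] at this
  unfold gromovProduct; linarith

theorem gromovProduct_le_add_dist (o p x y : X) :
    gromovProduct o x y ≤ gromovProduct p x y + dist o p := by
  have h1 := dist_triangle o p x
  have h2 := dist_triangle o p y
  unfold gromovProduct; linarith

theorem gromovProduct_le_add_dist_add_dist (o x y x' y' : X) :
    gromovProduct o x y ≤ gromovProduct o x' y' + dist x x' + dist y y' := by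
  have h1 := dist_triangle o x' x
  have h2 := dist_triangle o y' y
  have h3 := dist_triangle x' x y'
  have h4 := dist_triangle x y y'
  rw [dist_comm x' x] at h1 h3
  rw [dist_comm y' y] at h2
  unfold gromovProduct; linarith

theorem gromovProduct_basepoint_left (x y : X) : gromovProduct x x y = 0 := by
  simp [gromovProduct]

theorem gromovProduct_basepoint_right (x y : X) : gromovProduct y x y = 0 := by
  simp [gromovProduct, dist_comm]

/-- The four-point condition with constant `δ`. -/
def FourPoint (δ : ℝ) (X : Type*) [MetricSpace X] : Prop :=
  ∀ x y z o : X, min (gromovProduct o x z) (gromovProduct o z y) - δ ≤ gromovProduct o x y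

end GromovProduct

/-! ### Rough segments from quasi-rulers -/

section CoarsePaths

variable {X : Type*} [MetricSpace X]

/-- `q` is a `C`-roughly isometric path from `x` to `y`, parametrised by `[0, dist x y]`. -/
structure IsRoughSegment (C : ℝ) (x y : X) (q : ℝ → X) : Prop where
  source : q 0 = x
  target : q (dist x y) = y
  dist_le : ∀ s ∈ Icc 0 (dist x y), ∀ t ∈ Icc 0 (dist x y), dist (q s) (q t) ≤ |s - t| + C
  le_dist : ∀ s ∈ Icc 0 (dist x y), ∀ t ∈ Icc 0 (dist x y), |s - t| ≤ dist (q s) (q t) + C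

/-- Any two points of `X` are joined by a `C`-rough segment. -/
def IsRoughlyGeodesic (C : ℝ) (X : Type*) [MetricSpace X] : Prop :=
  ∀ x y : X, ∃ q, IsRoughSegment C x y q

/-- `c` restricted to `[0, L]` is a `(K, C)`-quasi-geodesic. -/
structure IsQuasiGeodesic (K C L : ℝ) (c : ℝ → X) : Prop where
  dist_le : ∀ s ∈ Icc 0 L, ∀ t ∈ Icc 0 L, dist (c s) (c t) ≤ K * |s - t| + C
  le_dist : ∀ s ∈ Icc 0 L, ∀ t ∈ Icc 0 L, |s - t| ≤ K * dist (c s) (c t) + C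

/-- A `(K, C)`-quasi-isometric embedding. -/
structure IsQIEmbedding {X' : Type*} [MetricSpace X'] (K C : ℝ) (f : X → X') : Prop where
  dist_le : ∀ x y, dist (f x) (f y) ≤ K * dist x y + C
  le_dist : ∀ x y, dist x y ≤ K * dist (f x) (f y) + C

theorem IsRoughSegment.gromovProduct_le {C : ℝ} {x y : X} {q : ℝ → X}
    (hq : IsRoughSegment C x y q) {s u t : ℝ} (hs : s ∈ Icc 0 (dist x y))
    (hu : u ∈ Icc 0 (dist x y)) (ht : t ∈ Icc 0 (dist x y)) (hsu : s ≤ u) (hut : u ≤ t) :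
    gromovProduct (q u) (q s) (q t) ≤ 3 / 2 * C := by
  have h1 := hq.dist_le u hu s hs
  have h2 := hq.dist_le u hu t ht
  have h3 := hq.le_dist s hs t ht
  rw [abs_of_nonneg (by linarith)] at h1
  rw [abs_sub_comm, abs_of_nonneg (by linarith)] at h2 h3
  unfold gromovProduct; linarith

theorem IsRoughSegment.gromovProduct_endpoints_le {C : ℝ} {x y : X} {q : ℝ → X}
    (hq : IsRoughSegment C x y q) {u : ℝ} (hu : u ∈ Icc 0 (dist x y)) :
    gromovProduct (q u) x y ≤ 3 / 2 * C := by
  have := hq.gromovProduct_le (left_mem_Icc.2 dist_nonneg) hu (right_mem_Icc.2 dist_nonneg)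
    hu.1 hu.2
  rwa [hq.source, hq.target] at this

theorem IsUnparametrisedQuasiRuler.eventually_dist_lt {D : ℝ} {I : Set ℝ} {γ : I → X}
    (h : IsUnparametrisedQuasiRuler D γ) (t₀ : I) : ∀ᶠ t in 𝓝 t₀, dist (γ t) (γ t₀) < D := by
  filter_upwards [eventually_lt_of_limsup_lt (h.2 t₀)] with t ht
  rw [edist_dist] at ht
  exact (ENNReal.ofReal_lt_ofReal_iff_of_nonneg dist_nonneg).1 ht

/-- A quasi-ruler reaches every intermediate distance from its starting point, coarsely. -/
theorem IsUnparametrisedQuasiRuler.exists_dist_near {D a b : ℝ} (hD : 0 ≤ D) (hab : a ≤ b)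
    {γ : Icc a b → X} (h : IsUnparametrisedQuasiRuler D γ) {s : ℝ} (hs : 0 ≤ s)
    (hs' : s ≤ dist (γ ⟨a, left_mem_Icc.2 hab⟩) (γ ⟨b, right_mem_Icc.2 hab⟩)) :
    ∃ t, |dist (γ ⟨a, left_mem_Icc.2 hab⟩) (γ t) - s| ≤ D := by
  set x := γ ⟨a, left_mem_Icc.2 hab⟩
  by_contra! hc
  -- Local jumps are smaller than D, but no distance from x lies within D of s. So the side of s is
  -- locally constant, against connectedness of the interval.
  have key : ∀ t₀, ∀ᶠ t in 𝓝 t₀, (dist x (γ t) ≤ s ↔ dist x (γ t₀) ≤ s) := by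
    intro t₀
    filter_upwards [h.eventually_dist_lt t₀] with t ht
    have h1 := dist_triangle x (γ t) (γ t₀)
    have h2 := dist_triangle x (γ t₀) (γ t)
    rw [dist_comm (γ t₀)] at h2
    have h3 := hc t
    have h4 := hc t₀
    constructor
    · intro h5
      rw [abs_of_nonpos (by linarith)] at h3
      linarith
    · intro h5
      rw [abs_of_nonpos (by linarith)] at h4
      linarith
  have hclopen : IsClopen {t : Icc a b | dist x (γ t) ≤ s} := by
    constructor
    · rw [← isOpen_compl_iff, isOpen_iff_mem_nhds]
      intro t₀ ht₀
      filter_upwards [key t₀] with t ht h'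
      exact ht₀ (ht.1 h')
    · rw [isOpen_iff_mem_nhds]
      intro t₀ ht₀
      filter_upwards [key t₀] with t ht
      exact ht.2 ht₀
  have : PreconnectedSpace (Icc a b) := Subtype.preconnectedSpace isPreconnected_Icc
  have huniv := hclopen.eq_univ ⟨⟨a, left_mem_Icc.2 hab⟩, by simpa [x] using hs⟩
  have hb : dist x (γ ⟨b, right_mem_Icc.2 hab⟩) ≤ s :=
    huniv.ge (mem_univ (⟨b, right_mem_Icc.2 hab⟩ : Icc a b))
  have := hc ⟨b, right_mem_Icc.2 hab⟩
  rw [le_antisymm hb hs', sub_self, abs_zero] at this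
  linarith

/-- The distance from the starting point is a rough isometry on a quasi-ruler. -/
theorem IsUnparametrisedQuasiRuler.dist_le_abs {D a b : ℝ} (hD : 0 ≤ D) (hab : a ≤ b)
    {γ : Icc a b → X} (h : IsUnparametrisedQuasiRuler D γ) (s t : Icc a b) :
    dist (γ s) (γ t) ≤
      |dist (γ ⟨a, left_mem_Icc.2 hab⟩) (γ s) - dist (γ ⟨a, left_mem_Icc.2 hab⟩) (γ t)| + D := by
  have key : ∀ s t : Icc a b, s < t → dist (γ s) (γ t) ≤
      |dist (γ ⟨a, left_mem_Icc.2 hab⟩) (γ s) - dist (γ ⟨a, left_mem_Icc.2 hab⟩) (γ t)| + D := by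
    intro s t hst
    rw [abs_sub_comm]
    rcases (Subtype.mk_le_mk.2 s.2.1 : (⟨a, left_mem_Icc.2 hab⟩ : Icc a b) ≤ s).eq_or_lt
      with h0 | h0
    · have h1 : s = ⟨a, left_mem_Icc.2 hab⟩ := h0.symm
      rw [h1, dist_self, sub_zero, abs_of_nonneg dist_nonneg]
      linarith
    · have := h.1 _ _ _ h0 hst
      linarith [le_abs_self (dist (γ ⟨a, left_mem_Icc.2 hab⟩) (γ t) -
        dist (γ ⟨a, left_mem_Icc.2 hab⟩) (γ s))]
  rcases lt_trichotomy s t with hst | rfl | hst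
  · exact key s t hst
  · simpa using hD
  · rw [dist_comm, abs_sub_comm]
    exact key t s hst

theorem AdmitsQuasiRuling.exists_isRoughlyGeodesic (h : AdmitsQuasiRuling X) :
    ∃ C, 0 ≤ C ∧ IsRoughlyGeodesic C X := by
  obtain ⟨D, hD, h⟩ := h
  -- One D from `dist_le_abs`, one for the choice of parameter at each of the two points.
  refine ⟨3 * D, by linarith, fun x y => ?_⟩
  obtain ⟨a, b, hab, γ, hγ, hx, hy⟩ := h x y
  -- The extreme parameters are treated apart so that the endpoints are hit exactly.
  have hex : ∀ s, ∃ t, s ∈ Icc 0 (dist x y) → |dist x (γ t) - s| ≤ D ∧ (s = 0 → γ t = x) ∧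
      (s = dist x y → γ t = y) := by
    intro s
    by_cases hs : s ∈ Icc 0 (dist x y)
    · by_cases h0 : s = 0
      · refine ⟨⟨a, left_mem_Icc.2 hab⟩, fun _ => ?_⟩
        rw [hx, h0]
        refine ⟨by simpa using hD, fun _ => rfl, fun h1 => dist_eq_zero.1 h1.symm⟩
      · by_cases h1 : s = dist x y
        · refine ⟨⟨b, right_mem_Icc.2 hab⟩, fun _ => ?_⟩
          rw [hy, h1]
          exact ⟨by simpa using hD, fun h2 => absurd (h1.trans h2) h0, fun _ => rfl⟩
        · obtain ⟨t, ht⟩ := hγ.exists_dist_near hD hab hs.1 (by rw [hx, hy]; exact hs.2)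
          rw [hx] at ht
          exact ⟨t, fun _ => ⟨ht, fun h2 => absurd h2 h0, fun h2 => absurd h2 h1⟩⟩
    · exact ⟨⟨a, left_mem_Icc.2 hab⟩, fun h' => absurd h' hs⟩
  choose τ hτ using hex
  refine ⟨fun s => γ (τ s), (hτ 0 (left_mem_Icc.2 dist_nonneg)).2.1 rfl,
    (hτ _ (right_mem_Icc.2 dist_nonneg)).2.2 rfl, fun s hs t ht => ?_, fun s hs t ht => ?_⟩
  · have h1 := hγ.dist_le_abs hD hab (τ s) (τ t)
    rw [hx] at h1
    have h2 := (hτ s hs).1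
    have h3 := (hτ t ht).1
    have h4 : |dist x (γ (τ s)) - dist x (γ (τ t))| ≤
        |s - t| + |dist x (γ (τ s)) - s| + |dist x (γ (τ t)) - t| := by
      rw [show dist x (γ (τ s)) - dist x (γ (τ t)) =
        (s - t) + (dist x (γ (τ s)) - s) - (dist x (γ (τ t)) - t) by ring]
      exact (abs_sub _ _).trans (by gcongr; exact abs_add_le _ _)
    linarith
  · have h1 : |dist x (γ (τ s)) - dist x (γ (τ t))| ≤ dist (γ (τ s)) (γ (τ t)) := by
      rw [dist_comm x, dist_comm x]; exact abs_dist_sub_le _ _ _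
    have h2 := (hτ s hs).1
    have h3 := (hτ t ht).1
    have h4 : |s - t| ≤ |dist x (γ (τ s)) - dist x (γ (τ t))| +
        |dist x (γ (τ t)) - t| + |dist x (γ (τ s)) - s| := by
      rw [show s - t = (dist x (γ (τ s)) - dist x (γ (τ t))) + (dist x (γ (τ t)) - t) -
        (dist x (γ (τ s)) - s) by ring]
      exact (abs_sub _ _).trans (by gcongr; exact abs_add_le _ _)
    linarith

/-- If `A` and `B` cover `[0, M]`, with `0` in `A` and `M` in `B`, then they come within
distance `1` of each other. -/
theorem exists_near_of_cover_Icc {M : ℝ} (hM : 0 ≤ M) {A B : ℝ → Prop}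
    (hAB : ∀ u ∈ Icc 0 M, A u ∨ B u) (hA : A 0) (hB : B M) :
    ∃ u ∈ Icc 0 M, ∃ v ∈ Icc 0 M, A u ∧ B v ∧ |u - v| ≤ 1 := by
  set S := {u | u ∈ Icc 0 M ∧ A u}
  have hne : S.Nonempty := ⟨0, left_mem_Icc.2 hM, hA⟩
  have hbdd : BddAbove S := ⟨M, fun u hu => hu.1.2⟩
  obtain ⟨u, ⟨hu, hAu⟩, hlt⟩ := exists_lt_of_lt_csSup hne (sub_one_lt (sSup S))
  by_cases h : u + 1 ≤ M
  · have hmem : u + 1 ∈ Icc 0 M := ⟨by linarith [hu.1], h⟩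
    refine ⟨u, hu, u + 1, hmem, hAu, (hAB _ hmem).resolve_left fun hA' => ?_, by simp⟩
    have := le_csSup hbdd (show u + 1 ∈ S from ⟨hmem, hA'⟩)
    linarith
  · refine ⟨u, hu, M, right_mem_Icc.2 hM, hAu, hB, ?_⟩
    rw [abs_sub_comm, abs_of_nonneg (by linarith [hu.2])]
    linarith

end CoarsePaths

/-! ### The Morse lemma for discontinuous quasi-geodesics -/

section Morse

variable {X : Type*} [MetricSpace X]

/-- Dyadic bisection: along a quasi-geodesic far from `p`, the Gromov product based at `p`
decreases only logarithmically. -/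
theorem IsQuasiGeodesic.le_gromovProduct {δ K C L r : ℝ} (hX : FourPoint δ X) (hK : 0 ≤ K)
    {c : ℝ → X} (hc : IsQuasiGeodesic K C L c) {p : X} (hp : ∀ t ∈ Icc 0 L, r ≤ dist p (c t))
    (k : ℕ) : ∀ s ∈ Icc 0 L, ∀ t ∈ Icc 0 L, |s - t| ≤ 2 ^ k →
      r - (K + C) - k * δ ≤ gromovProduct p (c s) (c t) := by
  induction k with
  | zero =>
    intro s hs t ht hst
    have h1 := dist_sub_dist_le_gromovProduct p (c s) (c t)
    have h2 := hp s hs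
    have h3 := hc.dist_le s hs t ht
    have h4 : K * |s - t| ≤ K * 1 := by gcongr; simpa using hst
    simp only [CharP.cast_eq_zero, zero_mul]
    linarith
  | succ k ih =>
    intro s hs t ht hst
    have hm : (s + t) / 2 ∈ Icc 0 L := ⟨by linarith [hs.1, ht.1], by linarith [hs.2, ht.2]⟩
    rw [pow_succ] at hst
    have h1 := ih s hs _ hm (by
      rw [show s - (s + t) / 2 = (s - t) / 2 by ring, abs_div, abs_two]; linarith)
    have h2 := ih _ hm t ht (by
      rw [show (s + t) / 2 - t = (s - t) / 2 by ring, abs_div, abs_two]; linarith)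
    have h3 := hX (c s) (c t) (c ((s + t) / 2)) p
    have h4 := le_min h1 h2
    push_cast
    linarith

/-- A quantity bounded by the logarithm of an affine function of itself is bounded. -/
theorem exists_bound_of_le_log (a b δ η : ℝ) (ha : 0 ≤ a) (hδ : 0 ≤ δ) :
    ∃ R : ℝ, ∀ r : ℝ, (∀ k : ℕ, a * r + b ≤ 2 ^ k → r ≤ k * δ + η) → r ≤ R := by
  have hlim : Tendsto (fun k : ℕ => (k : ℝ) / 2 ^ k) atTop (𝓝 0) := by
    simpa using tendsto_pow_const_div_const_pow_of_one_lt 1 (one_lt_two (α := ℝ))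
  have hlim' : Tendsto (fun k : ℕ => (1 : ℝ) / 2 ^ k) atTop (𝓝 0) := by
    simpa using tendsto_pow_atTop_nhds_zero_of_lt_one (r := (1 / 2 : ℝ)) (by norm_num)
      (by norm_num)
  -- The shift by one is there because the least admissible exponent k + 1 is played against the
  -- failure of k.
  have hev : ∀ᶠ k : ℕ in atTop, a * ((k + 1 : ℕ) * δ + η) + b < 2 ^ k := by
    have h := (hlim.const_mul (a * δ)).add (hlim'.const_mul (a * δ + a * η + b))
    simp only [mul_zero, add_zero] at h
    filter_upwards [h.eventually (gt_mem_nhds one_pos)] with k hk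
    have h2 : (0 : ℝ) < 2 ^ k := by positivity
    rw [← mul_div_assoc, ← mul_div_assoc, ← add_div, div_lt_one h2] at hk
    push_cast
    linarith
  obtain ⟨N, hN⟩ := eventually_atTop.1 hev
  refine ⟨N * δ + η, fun r hr => ?_⟩
  have hex : ∃ k : ℕ, a * r + b ≤ 2 ^ k := by
    obtain ⟨k, hk⟩ := pow_unbounded_of_one_lt (a * r + b) (one_lt_two (α := ℝ))
    exact ⟨k, hk.le⟩
  classical
  by_cases hk : Nat.find hex ≤ N
  · refine (hr _ (Nat.find_spec hex)).trans ?_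
    gcongr
  · obtain ⟨j, hj⟩ : ∃ j, Nat.find hex = j + 1 := Nat.exists_eq_succ_of_ne_zero (by omega)
    have h1 : 2 ^ j < a * r + b := not_le.1 (Nat.find_min hex (by omega))
    have h2 := hr _ (Nat.find_spec hex)
    rw [hj] at h2
    have h3 := hN j (by omega)
    have h4 := mul_le_mul_of_nonneg_left h2 ha
    linarith

/-- Morse lemma: rough segments stay near quasi-geodesics with the same endpoints. -/
theorem exists_roughSegment_near_quasiGeodesic {δ K C C₀ : ℝ} (hδ : 0 ≤ δ) (hX : FourPoint δ X)
    (hK : 0 ≤ K) (hC₀ : 0 ≤ C₀) :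
    ∃ H, 0 ≤ H ∧ ∀ (L : ℝ) (c q : ℝ → X), 0 ≤ L → IsQuasiGeodesic K C L c →
      IsRoughSegment C₀ (c 0) (c L) q →
      ∀ u ∈ Icc 0 (dist (c 0) (c L)), ∃ t ∈ Icc 0 L, dist (q u) (c t) ≤ H := by
  -- The affine function bounds |t₁ - t₂| below, via d(c t₁, c t₂) ≤ 6(r + 2) + 3C₀; the last
  -- constant collects the losses in the four-point chain.
  obtain ⟨R, hR⟩ := exists_bound_of_le_log (6 * K) (K * (12 + 3 * C₀) + C) δ
    (3 / 2 * C₀ + (K + C) + 2 * δ) (by positivity) hδ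
  refine ⟨max R 0 + 2, by positivity, fun L c q hL hc hq => ?_⟩
  set M := dist (c 0) (c L)
  have hM : 0 ≤ M := dist_nonneg
  have h0L : (0 : ℝ) ∈ Icc 0 L := left_mem_Icc.2 hL
  have hLL : L ∈ Icc 0 L := right_mem_Icc.2 hL
  have h0M : (0 : ℝ) ∈ Icc 0 M := left_mem_Icc.2 hM
  have hMM : M ∈ Icc 0 M := right_mem_Icc.2 hM
  set S := {r : ℝ | ∃ u ∈ Icc 0 M, ∀ t ∈ Icc 0 L, r ≤ dist (q u) (c t)}
  have hne : S.Nonempty := ⟨0, 0, h0M, fun t _ => dist_nonneg⟩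
  have hbdd : BddAbove S := by
    refine ⟨M + C₀, ?_⟩
    rintro r ⟨u, hu, hr⟩
    have h1 := hr 0 h0L
    have h2 := hq.dist_le u hu 0 h0M
    rw [hq.source, sub_zero, abs_of_nonneg hu.1] at h2
    linarith [hu.2]
  -- An almost farthest point of q from c: the supremum need not be attained, which costs 1 here and
  -- 1 more in `hnear`.
  obtain ⟨r, ⟨u, hu, hr⟩, hlt⟩ := exists_lt_of_lt_csSup hne (sub_one_lt (sSup S))
  have h0S : 0 ≤ sSup S := le_csSup hbdd ⟨0, h0M, fun t _ => dist_nonneg⟩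
  have hnear : ∀ v ∈ Icc 0 M, ∃ t ∈ Icc 0 L, dist (q v) (c t) ≤ r + 2 := by
    intro v hv
    by_contra! hcon
    have : sSup S + 1 ∈ S := ⟨v, hv, fun t ht => by linarith [hcon t ht]⟩
    linarith [le_csSup hbdd this]
  have hrho : 0 ≤ r + 2 := by linarith
  -- Walk back until q v is at least 2(r + 2) from q u, so that a jump of r + 2 to c keeps the
  -- product large; if the segment ends first, its endpoint already lies on c.
  have side₁ : ∃ v ∈ Icc 0 M, ∃ t ∈ Icc 0 L, v ≤ u ∧ u - v ≤ 2 * (r + 2) + C₀ ∧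
      dist (q v) (c t) ≤ r + 2 ∧ r ≤ gromovProduct (q u) (q v) (c t) := by
    by_cases h : 2 * (r + 2) + C₀ ≤ u
    · have hv : u - (2 * (r + 2) + C₀) ∈ Icc 0 M := ⟨by linarith, by linarith [hu.2]⟩
      obtain ⟨t, ht, hd⟩ := hnear _ hv
      refine ⟨_, hv, t, ht, by linarith, by linarith, hd, ?_⟩
      have h1 := hq.le_dist u hu _ hv
      rw [sub_sub_cancel, abs_of_nonneg (by linarith)] at h1
      linarith [dist_sub_dist_le_gromovProduct (q u) (q (u - (2 * (r + 2) + C₀))) (c t)]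
    · refine ⟨0, h0M, 0, h0L, hu.1, by linarith, ?_, ?_⟩
      · rw [hq.source, dist_self]; exact hrho
      · rw [hq.source, gromovProduct_self]; exact hr 0 h0L
  have side₂ : ∃ v ∈ Icc 0 M, ∃ t ∈ Icc 0 L, u ≤ v ∧ v - u ≤ 2 * (r + 2) + C₀ ∧
      dist (q v) (c t) ≤ r + 2 ∧ r ≤ gromovProduct (q u) (q v) (c t) := by
    by_cases h : u + (2 * (r + 2) + C₀) ≤ M
    · have hv : u + (2 * (r + 2) + C₀) ∈ Icc 0 M := ⟨by linarith [hu.1], h⟩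
      obtain ⟨t, ht, hd⟩ := hnear _ hv
      refine ⟨_, hv, t, ht, by linarith, by linarith, hd, ?_⟩
      have h1 := hq.le_dist _ hv u hu
      rw [add_sub_cancel_left, abs_of_nonneg (by linarith), dist_comm] at h1
      linarith [dist_sub_dist_le_gromovProduct (q u) (q (u + (2 * (r + 2) + C₀))) (c t)]
    · refine ⟨M, hMM, L, hLL, hu.2, by linarith, ?_, ?_⟩
      · rw [hq.target, dist_self]; exact hrho
      · rw [hq.target, gromovProduct_self]; exact hr L hLL
  obtain ⟨v₁, hv₁, t₁, ht₁, hvu₁, huv₁, hd₁, hg₁⟩ := side₁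
  obtain ⟨v₂, hv₂, t₂, ht₂, hvu₂, huv₂, hd₂, hg₂⟩ := side₂
  have hrR : r ≤ R := by
    refine hR r fun k hk => ?_
    have hct : |t₁ - t₂| ≤ 2 ^ k := by
      refine (hc.le_dist t₁ ht₁ t₂ ht₂).trans (le_trans ?_ hk)
      have h1 := hq.dist_le v₁ hv₁ v₂ hv₂
      rw [abs_sub_comm, abs_of_nonneg (by linarith)] at h1
      have h2 := dist_triangle4_left (q v₁) (q v₂) (c t₁) (c t₂)
      have h3 : dist (c t₁) (c t₂) ≤ 6 * r + (12 + 3 * C₀) := by linarith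
      have h4 := mul_le_mul_of_nonneg_left h3 hK
      linarith
    have hg := hc.le_gromovProduct hX hK hr k t₁ ht₁ t₂ ht₂ hct
    -- Along the chain q v₁, c t₁, c t₂, q v₂ consecutive products at q u are large, while the
    -- product of the ends is at most 3C₀/2 because q u lies between them.
    have h1 := hX (q v₁) (q v₂) (c t₁) (q u)
    have h2 := hX (c t₁) (q v₂) (c t₂) (q u)
    rw [gromovProduct_comm] at hg₂
    have h3 := hq.gromovProduct_le hv₁ hu hv₂ hvu₁ hvu₂
    rcases min_choice (gromovProduct (q u) (q v₁) (c t₁)) (gromovProduct (q u) (c t₁) (q v₂))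
      with h4 | h4 <;>
    rcases min_choice (gromovProduct (q u) (c t₁) (c t₂)) (gromovProduct (q u) (c t₂) (q v₂))
      with h5 | h5 <;>
    · rw [h4] at h1
      rw [h5] at h2
      have hkδ : 0 ≤ (k : ℝ) * δ := by positivity
      have hKC : 0 ≤ K + C := by
        have := hc.dist_le 0 h0L 0 h0L
        simp only [dist_self, sub_self, abs_zero, mul_zero, zero_add] at this
        linarith
      linarith
  intro v hv
  obtain ⟨t, ht, hd⟩ := hnear v hv
  exact ⟨t, ht, hd.trans (by gcongr; exact hrR.trans (le_max_left _ _))⟩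

/-- Morse lemma: quasi-geodesics stay near rough segments with the same endpoints. -/
theorem exists_quasiGeodesic_near_roughSegment {δ K C C₀ : ℝ} (hδ : 0 ≤ δ) (hX : FourPoint δ X)
    (hK : 0 ≤ K) (hC₀ : 0 ≤ C₀) :
    ∃ H, ∀ (L : ℝ) (c q : ℝ → X), 0 ≤ L → IsQuasiGeodesic K C L c →
      IsRoughSegment C₀ (c 0) (c L) q →
      ∀ t ∈ Icc 0 L, ∃ u ∈ Icc 0 (dist (c 0) (c L)), dist (c t) (q u) ≤ H := by
  obtain ⟨H, hH, h⟩ := exists_roughSegment_near_quasiGeodesic (C := C) hδ hX hK hC₀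
  refine ⟨K * (K * (2 * H + (1 + C₀)) + C) + C + H, fun L c q hL hc hq t ht => ?_⟩
  -- Points of q are sorted by whether they lie near c before or after time t. Where the two kinds
  -- meet, c s₁ and c s₂ are close with s₁ ≤ t ≤ s₂, which traps t.
  obtain ⟨u, hu, v, hv, ⟨s₁, hs₁, hst₁, hd₁⟩, ⟨s₂, hs₂, hst₂, hd₂⟩, huv⟩ :=
    exists_near_of_cover_Icc (M := dist (c 0) (c L)) dist_nonneg
      (A := fun u => ∃ s ∈ Icc 0 L, s ≤ t ∧ dist (q u) (c s) ≤ H)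
      (B := fun u => ∃ s ∈ Icc 0 L, t ≤ s ∧ dist (q u) (c s) ≤ H)
      (fun u hu => by
        obtain ⟨s, hs, hd⟩ := h L c q hL hc hq u hu
        rcases le_total s t with hst | hst
        · exact Or.inl ⟨s, hs, hst, hd⟩
        · exact Or.inr ⟨s, hs, hst, hd⟩)
      ⟨0, left_mem_Icc.2 hL, ht.1, by rwa [hq.source, dist_self]⟩
      ⟨L, right_mem_Icc.2 hL, ht.2, by rwa [hq.target, dist_self]⟩
  refine ⟨u, hu, ?_⟩
  have h1 := hq.dist_le u hu v hv
  have h2 := dist_triangle4_left (q u) (q v) (c s₁) (c s₂)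
  have h3 : dist (c s₁) (c s₂) ≤ 2 * H + (1 + C₀) := by linarith
  have h4 := hc.le_dist s₁ hs₁ s₂ hs₂
  have h5 := hc.dist_le t ht s₁ hs₁
  have h6 : |t - s₁| ≤ |s₁ - s₂| := by
    rw [abs_of_nonneg (by linarith), abs_sub_comm, abs_of_nonneg (by linarith)]; linarith
  have h7 : |t - s₁| ≤ K * (2 * H + (1 + C₀)) + C := by
    have := mul_le_mul_of_nonneg_left h3 hK
    linarith
  have h8 := mul_le_mul_of_nonneg_left h7 hK
  have h9 := dist_triangle_right (c t) (q u) (c s₁)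
  linarith

/-- In a hyperbolic space the distance from `p` to a rough segment is at most, up to an additive
constant, the Gromov product of its endpoints. -/
theorem IsRoughSegment.exists_dist_le_gromovProduct {δ C : ℝ} (hX : FourPoint δ X) {x y : X}
    {q : ℝ → X} (hq : IsRoughSegment C x y q) (p : X) :
    ∃ u ∈ Icc 0 (dist x y), dist p (q u) ≤ gromovProduct p x y + (3 * C + 2 * δ) := by
  -- The witness is the parameter at which the tripod on x, y, p branches off [x, y].
  have hu : gromovProduct x p y ∈ Icc 0 (dist x y) := by
    have h1 := dist_triangle p x y
    have h2 := dist_triangle x y p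
    rw [dist_comm p x] at h1
    rw [dist_comm y p] at h2
    constructor <;> unfold gromovProduct <;> linarith
  refine ⟨_, hu, ?_⟩
  set u := gromovProduct x p y with hu_def
  have h1 := hq.dist_le _ (left_mem_Icc.2 dist_nonneg) u hu
  have h2 := hq.le_dist _ (left_mem_Icc.2 dist_nonneg) u hu
  have h3 := hq.dist_le u hu _ (right_mem_Icc.2 dist_nonneg)
  rw [abs_sub_comm, sub_zero, abs_of_nonneg hu.1, hq.source] at h1 h2
  rw [abs_sub_comm, abs_of_nonneg (by linarith [hu.2]), hq.target, dist_comm] at h3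
  have h4 := hX p (q u) y x
  have h5 : u - C ≤ gromovProduct x y (q u) := by unfold gromovProduct; linarith
  have h6 := le_min (hu_def.le.trans' (sub_le_self u (by linarith : 0 ≤ C))) h5
  have h7 : u - C - δ ≤ gromovProduct x p (q u) := by linarith
  unfold gromovProduct at h7 hu_def ⊢
  rw [dist_comm x p] at h7 hu_def
  linarith

end Morse

/-! ### Distortion of Gromov products and transfer of hyperbolicity -/

section QuasiIsometries

variable {X X' : Type*} [MetricSpace X] [MetricSpace X']

theorem IsQIEmbedding.comp_roughSegment {K C C₀ : ℝ} (hK : 0 ≤ K) {f : X → X'}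
    (hC₀ : 0 ≤ C₀) (hf : IsQIEmbedding K C f) {x y : X} {q : ℝ → X}
    (hq : IsRoughSegment C₀ x y q) :
    IsQuasiGeodesic K (C + K * C₀ + C₀) (dist x y) (f ∘ q) := by
  constructor
  · intro s hs t ht
    have h1 := hf.dist_le (q s) (q t)
    have h2 := mul_le_mul_of_nonneg_left (hq.dist_le s hs t ht) hK
    simp only [Function.comp]
    linarith
  · intro s hs t ht
    have h1 := hf.le_dist (q s) (q t)
    have h2 := hq.le_dist s hs t ht
    have h3 := mul_nonneg hK hC₀
    simp only [Function.comp]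
    linarith

/-- A quasi-isometric embedding into a hyperbolic space distorts Gromov products linearly. -/
theorem IsQIEmbedding.exists_gromovProduct_le {δ K C C₀ : ℝ} (hδ : 0 ≤ δ) (hX' : FourPoint δ X')
    (hK : 0 ≤ K) (hC₀ : 0 ≤ C₀) (hgX : IsRoughlyGeodesic C₀ X) (hgX' : IsRoughlyGeodesic C₀ X')
    {f : X → X'} (hf : IsQIEmbedding K C f) :
    ∃ A, ∀ o x y : X, gromovProduct o x y ≤ K * gromovProduct (f o) (f x) (f y) + A := by
  obtain ⟨H, -, h⟩ := exists_roughSegment_near_quasiGeodesic (C := C + K * C₀ + C₀) hδ hX' hK hC₀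
  refine ⟨K * (3 * C₀ + 2 * δ + H) + C + 3 / 2 * C₀, fun o x y => ?_⟩
  obtain ⟨q, hq⟩ := hgX x y
  obtain ⟨q', hq'⟩ := hgX' (f x) (f y)
  -- The product in X' nearly reaches the distance from f o to [f x, f y]. The Morse lemma moves the
  -- nearby point onto f ∘ q, and d(o, q t) bounds the product in X.
  obtain ⟨u, hu, hd⟩ := hq'.exists_dist_le_gromovProduct hX' (f o)
  have e0 : (f ∘ q) 0 = f x := by simp [hq.source]
  have e1 : (f ∘ q) (dist x y) = f y := by simp [hq.target]
  obtain ⟨t, ht, hd'⟩ := h _ (f ∘ q) q' dist_nonneg (hf.comp_roughSegment hK hC₀ hq)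
    (by rwa [e0, e1]) u (by rwa [e0, e1])
  have h1 := hf.le_dist o (q t)
  have h2 := dist_triangle (f o) (q' u) ((f ∘ q) t)
  simp only [Function.comp] at h2 hd'
  have h3 : dist (f o) (f (q t)) ≤ gromovProduct (f o) (f x) (f y) + (3 * C₀ + 2 * δ + H) := by
    linarith
  have h4 := mul_le_mul_of_nonneg_left h3 hK
  have h5 := hq.gromovProduct_endpoints_le ht
  have h6 := gromovProduct_le_add_dist o (q t) x y
  linarith

/-- If every rough segment `[x, y]` is contained in coarse neighbourhoods of `[x, z]` and
`[z, y]`, the space is hyperbolic. -/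
theorem exists_fourPoint_of_thin {C₀ c : ℝ} (hC₀ : 0 ≤ C₀) (hc : 0 ≤ c)
    (hg : IsRoughlyGeodesic C₀ X)
    (hthin : ∀ (x y z : X) (q : ℝ → X), IsRoughSegment C₀ x y q → ∀ u ∈ Icc 0 (dist x y),
      gromovProduct (q u) x z ≤ c ∨ gromovProduct (q u) z y ≤ c) :
    ∃ δ, 0 ≤ δ ∧ FourPoint δ X := by
  refine ⟨3 * c + (1 + C₀), by linarith, fun x y z o => ?_⟩
  obtain ⟨q, hq⟩ := hg x y
  -- Thinness with third vertex o gives a point q u with d(o, q u) at most (x|y)_o plus a constant.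
  -- Thinness with third vertex z then bounds one of (x|z)_o, (z|y)_o by d(o, q u) + c.
  obtain ⟨u, hu, v, hv, hA, hB, huv⟩ := exists_near_of_cover_Icc (M := dist x y) dist_nonneg
    (hthin x y o q hq) (by rwa [hq.source, gromovProduct_basepoint_left])
    (by rwa [hq.target, gromovProduct_basepoint_right])
  have h1 := gromovProduct_le_add_dist (q u) (q v) o y
  have h2 := hq.dist_le u hu v hv
  have h3 := dist_triangle_left x y (q u)
  have h4 : dist o (q u) - (2 * c + (1 + C₀)) ≤ gromovProduct o x y := by
    unfold gromovProduct at *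
    rw [dist_comm o x, dist_comm o (q u)]
    linarith
  rcases hthin x y z q hq u hu with h5 | h5
  · have h6 := gromovProduct_le_add_dist o (q u) x z
    have h7 := min_le_left (gromovProduct o x z) (gromovProduct o z y)
    linarith
  · have h6 := gromovProduct_le_add_dist o (q u) z y
    have h7 := min_le_right (gromovProduct o x z) (gromovProduct o z y)
    linarith

/-- Hyperbolicity passes to the source of a quasi-isometric embedding, for roughly geodesic
spaces. -/
theorem IsQIEmbedding.exists_fourPoint {δ K C C₀ : ℝ} (hδ : 0 ≤ δ) (hX' : FourPoint δ X')
    (hK : 0 ≤ K) (hC₀ : 0 ≤ C₀) (hgX : IsRoughlyGeodesic C₀ X) (hgX' : IsRoughlyGeodesic C₀ X')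
    {f : X → X'} (hf : IsQIEmbedding K C f) : ∃ δ', 0 ≤ δ' ∧ FourPoint δ' X := by
  obtain ⟨A, hA⟩ := hf.exists_gromovProduct_le hδ hX' hK hC₀ hgX hgX'
  obtain ⟨H, h⟩ := exists_quasiGeodesic_near_roughSegment (C := C + K * C₀ + C₀) hδ hX' hK hC₀
  refine exists_fourPoint_of_thin hC₀ (c := max 0 (K * (3 / 2 * C₀ + H + δ) + A))
    (le_max_left _ _) hgX fun x y z q hq u hu => ?_
  obtain ⟨q', hq'⟩ := hgX' (f x) (f y)
  have e0 : (f ∘ q) 0 = f x := by simp [hq.source]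
  have e1 : (f ∘ q) (dist x y) = f y := by simp [hq.target]
  -- Since f (q u) is near [f x, f y], the four-point condition in X' bounds one of the two products
  -- with f z, and `hA` carries that bound back to X.
  obtain ⟨t, ht, hd⟩ := h _ (f ∘ q) q' dist_nonneg (hf.comp_roughSegment hK hC₀ hq)
    (by rwa [e0, e1]) u hu
  rw [e0, e1] at ht
  have h1 := gromovProduct_le_add_dist (f (q u)) (q' t) (f x) (f y)
  have h2 := hq'.gromovProduct_endpoints_le ht
  have h3 := hX' (f x) (f y) (f z) (f (q u))
  simp only [Function.comp] at hd
  have h4 : min (gromovProduct (f (q u)) (f x) (f z)) (gromovProduct (f (q u)) (f z) (f y)) ≤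
      3 / 2 * C₀ + H + δ := by linarith
  rcases min_le_iff.1 h4 with h5 | h5
  · left
    exact ((hA (q u) x z).trans (by gcongr)).trans (le_max_right _ _)
  · right
    exact ((hA (q u) z y).trans (by gcongr)).trans (le_max_right _ _)

/-- A quasi-isometry has a quasi-inverse. -/
theorem IsQuasiIsometry.exists_quasiInverse {f : X → X'} (hf : IsQuasiIsometry f) :
    ∃ (K C : ℝ) (g : X' → X), 1 ≤ K ∧ IsQIEmbedding K C f ∧ IsQIEmbedding K C g ∧
      (∀ x, dist (g (f x)) x ≤ C) ∧ ∀ x', dist (f (g x')) x' ≤ C := by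
  obtain ⟨K, C, hK, hC, hf, hsurj⟩ := hf
  choose g hg using hsurj
  have hK0 : 0 < K := by linarith
  have hKC : C ≤ K * C := le_mul_of_one_le_left hC hK
  have hle : ∀ x y, dist x y ≤ K * dist (f x) (f y) + K * C := by
    intro x y
    have h1 := mul_le_mul_of_nonneg_left (hf x y).1 hK0.le
    rw [mul_sub, ← mul_assoc, mul_one_div_cancel hK0.ne', one_mul] at h1
    linarith
  -- The upper bound for g needs the factor 3: K * C from inverting f, and 2 * (K * C) from
  -- replacing f (g x), f (g y) by x, y.
  refine ⟨K, 3 * (K * C), g, hK, ⟨fun x y => ?_, fun x y => ?_⟩, ⟨fun x y => ?_, fun x y => ?_⟩,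
    fun x => ?_, fun x' => ?_⟩
  · linarith [(hf x y).2]
  · linarith [hle x y]
  · have h1 := hle (g x) (g y)
    have h2 := dist_triangle4_right (f (g x)) (f (g y)) x y
    have h3 : dist (f (g x)) (f (g y)) ≤ dist x y + 2 * C := by linarith [hg x, hg y]
    have h4 := mul_le_mul_of_nonneg_left h3 hK0.le
    linarith
  · have h1 := (hf (g x) (g y)).2
    have h2 := dist_triangle4_left (f (g x)) (f (g y)) x y
    linarith [hg x, hg y]
  · have h1 := hle (g (f x)) x
    have h2 := mul_le_mul_of_nonneg_left (hg (f x)) hK0.le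
    linarith
  · linarith [hg x']

end QuasiIsometries

/-! ### Induced maps on Gromov boundaries -/

section Boundary

variable {X X' : Type*} [MetricSpace X] [MetricSpace X']

/-- `f` preserves divergence of Gromov products, linearly and for all base points. -/
def IsBoundaryRegular (f : X → X') : Prop :=
  ∃ K, 0 < K ∧ ∀ (o : X) (o' : X'), ∃ A, ∀ x y : X,
    gromovProduct o x y ≤ K * gromovProduct o' (f x) (f y) + A

theorem isBoundaryRegular_of_gromovProduct_le {f : X → X'} {K A : ℝ} (hK : 0 < K)
    (h : ∀ o x y : X, gromovProduct o x y ≤ K * gromovProduct (f o) (f x) (f y) + A) :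
    IsBoundaryRegular f := by
  refine ⟨K, hK, fun o o' => ⟨K * dist (f o) o' + A, fun x y => ?_⟩⟩
  have h1 := mul_le_mul_of_nonneg_left (gromovProduct_le_add_dist (f o) o' (f x) (f y)) hK.le
  linarith [h o x y]

/-- A general filter covers both convergence to infinity (pairs of indices) and equivalence (single
indices). The base point in X is taken from the family itself, hence the separate case of an empty
index type. -/
theorem IsBoundaryRegular.tendsto {f : X → X'} (hf : IsBoundaryRegular f) {ι : Type*}
    {l : Filter ι} {x y : ι → X}
    (h : ∀ o, Tendsto (fun i => gromovProduct o (x i) (y i)) l atTop) (o' : X') :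
    Tendsto (fun i => gromovProduct o' (f (x i)) (f (y i))) l atTop := by
  rcases isEmpty_or_nonempty ι with hι | ⟨⟨i₀⟩⟩
  · rw [filter_eq_bot_of_isEmpty l]; exact tendsto_bot
  obtain ⟨K, hK, hf⟩ := hf
  obtain ⟨A, hA⟩ := hf (x i₀) o'
  rw [tendsto_atTop]
  intro b
  filter_upwards [tendsto_atTop.1 (h (x i₀)) (K * b + A)] with i hi
  exact le_of_mul_le_mul_left (by linarith [hA (x i) (y i)]) hK

theorem IsBoundaryRegular.convergesToInfinity {f : X → X'} (hf : IsBoundaryRegular f)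
    {x : ℕ → X} (hx : ConvergesToInfinity x) : ConvergesToInfinity (f ∘ x) :=
  hf.tendsto hx

theorem IsBoundaryRegular.equivalentAtInfinity {f : X → X'} (hf : IsBoundaryRegular f)
    {x y : ℕ → X} (h : EquivalentAtInfinity x y) : EquivalentAtInfinity (f ∘ x) (f ∘ y) :=
  hf.tendsto h

/-- The product is at least d(o, x i) - C, and d(o, x i) is the diagonal product, which diverges. -/
theorem EquivalentAtInfinity.of_dist_le {x y : ℕ → X} (hx : ConvergesToInfinity x) {C : ℝ}
    (h : ∀ i, dist (y i) (x i) ≤ C) : EquivalentAtInfinity y x := by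
  intro o
  refine tendsto_atTop_mono (fun i => ?_)
    (tendsto_atTop_add_const_right _ (-C) ((hx o).comp tendsto_atTop_diagonal))
  have h1 := dist_sub_dist_le_gromovProduct o (x i) (y i)
  rw [gromovProduct_comm, dist_comm (x i)] at h1
  simp only [Function.comp, gromovProduct_self]
  linarith [h i]

variable [IsGromovHyperbolic X] [IsGromovHyperbolic X']

/-- The map induced on Gromov boundaries. -/
def GromovBoundary.map (f : X → X') (hf : IsBoundaryRegular f) :
    GromovBoundary X → GromovBoundary X' :=
  Quotient.map (fun x => ⟨f ∘ x.1, hf.convergesToInfinity x.2⟩)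
    fun _ _ h => hf.equivalentAtInfinity h

theorem GromovBoundary.Represents.map {f : X → X'} (hf : IsBoundaryRegular f) {x : ℕ → X}
    {ξ : GromovBoundary X} (h : GromovBoundary.Represents x ξ) :
    GromovBoundary.Represents (f ∘ x) (GromovBoundary.map f hf ξ) := by
  obtain ⟨hx, rfl⟩ := h
  exact ⟨hf.convergesToInfinity hx, rfl⟩

theorem GromovBoundary.map_map_of_dist_le {f : X → X'} {g : X' → X} (hf : IsBoundaryRegular f)
    (hg : IsBoundaryRegular g) {C : ℝ} (h : ∀ x, dist (g (f x)) x ≤ C) (ξ : GromovBoundary X) :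
    GromovBoundary.map g hg (GromovBoundary.map f hf ξ) = ξ := by
  induction ξ using Quotient.inductionOn with
  | h x => exact Quotient.sound (EquivalentAtInfinity.of_dist_le x.2 fun i => h (x.1 i))

/-- The product of the image points is an infimum over all representatives, not only those of the
form f ∘ x. Arbitrary ones are pulled back by g to representatives of the original points, then
compared with their images under f ∘ g at a cost of 2C. -/
theorem GromovBoundary.continuous_map {f : X → X'} {g : X' → X} (hf : IsBoundaryRegular f)
    (hg : IsBoundaryRegular g) {C : ℝ} (hgf : ∀ x, dist (g (f x)) x ≤ C)
    (hfg : ∀ x', dist (f (g x')) x' ≤ C) (o : X) (o' : X') :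
    Continuous[visualTopology o, visualTopology o'] (GromovBoundary.map f hf) := by
  have hf' := hf
  obtain ⟨K, hK, hf'⟩ := hf'
  obtain ⟨A, hA⟩ := hf' o o'
  refine @Continuous.mk _ _ (visualTopology o) (visualTopology o') _ fun U hU ξ hξ => ?_
  obtain ⟨R, -, hRU⟩ := hU _ hξ
  -- The extra 1 keeps the inequality strict through the lower limit and the infimum.
  refine ⟨max 0 (K * (R + 1 + 2 * C) + A), le_max_left _ _, fun η hη => hRU ?_⟩
  have hη' : ((K * (R + 1 + 2 * C) + A : ℝ) : EReal) < boundaryGromovProduct o ξ η :=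
    lt_of_le_of_lt (EReal.coe_le_coe_iff.2 (le_max_right _ _)) hη
  refine lt_of_lt_of_le (EReal.coe_lt_coe_iff.2 (lt_add_one R))
    (le_iInf fun x => le_iInf fun y => le_iInf fun hx => le_iInf fun hy => ?_)
  have hx' := hx.map hg
  have hy' := hy.map hg
  rw [GromovBoundary.map_map_of_dist_le hf hg hgf] at hx' hy'
  have hlt := hη'.trans_le (iInf_le_of_le (g ∘ x) (iInf_le_of_le (g ∘ y)
    (iInf_le_of_le hx' (iInf_le_of_le hy' le_rfl))))
  refine le_liminf_of_le (by isBoundedDefault) ?_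
  filter_upwards [eventually_lt_of_lt_liminf hlt] with i hi
  rw [EReal.coe_lt_coe_iff] at hi
  rw [EReal.coe_le_coe_iff]
  simp only [Function.comp] at hi
  have h1 := hA (g (x i)) (g (y i))
  have h2 := gromovProduct_le_add_dist_add_dist o' (f (g (x i))) (f (g (y i))) (x i) (y i)
  have h3 : R + 1 + 2 * C < gromovProduct o' (f (g (x i))) (f (g (y i))) :=
    lt_of_mul_lt_mul_left (by linarith) hK.le
  linarith [hfg (x i), hfg (y i)]

end Boundary

/-! ### Assembling the theorem -/

theorem IsRoughlyGeodesic.mono {X : Type*} [MetricSpace X] {C C' : ℝ} (hC : C ≤ C')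
    (h : IsRoughlyGeodesic C X) : IsRoughlyGeodesic C' X := by
  intro x y
  obtain ⟨q, h0, h1, h2, h3⟩ := h x y
  exact ⟨q, h0, h1, fun s hs t ht => (h2 s hs t ht).trans (by gcongr),
    fun s hs t ht => (h3 s hs t ht).trans (by gcongr)⟩

theorem mainTheorem8 {X : Type*} {X' : Type*} [MetricSpace X] [MetricSpace X']
    [IsGromovHyperbolic X] (hX : AdmitsQuasiRuling X) (hX' : AdmitsQuasiRuling X')
    (f : X → X') (hf : IsQuasiIsometry f) :
    ∃ _ : IsGromovHyperbolic X', ∃ F : GromovBoundary X ≃ GromovBoundary X',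
      (∀ (o : X) (o' : X'),
        Continuous[visualTopology o, visualTopology o'] F ∧
        Continuous[visualTopology o', visualTopology o] F.symm) ∧
      (∀ (x : ℕ → X) (ξ : GromovBoundary X), GromovBoundary.Represents x ξ →
        GromovBoundary.Represents (f ∘ x) (F ξ)) ∧
      (∀ (a : ℝ) (γ : Set.Ici a → X) (ξ : GromovBoundary X), DefinesBoundaryPoint γ ξ →
        DefinesBoundaryPoint (f ∘ γ) (F ξ)) := by
  obtain ⟨C₁, hC₁, hgX⟩ := hX.exists_isRoughlyGeodesic
  obtain ⟨C₂, -, hgX'⟩ := hX'.exists_isRoughlyGeodesic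
  have hC₀ : 0 ≤ max C₁ C₂ := hC₁.trans (le_max_left _ _)
  replace hgX := hgX.mono (le_max_left C₁ C₂)
  replace hgX' := hgX'.mono (le_max_right C₁ C₂)
  obtain ⟨K, C, g, hK, hfqi, hgqi, hgf, hfg⟩ := hf.exists_quasiInverse
  have hK0 : 0 < K := by linarith
  obtain ⟨δ, hδ, hδX⟩ := IsGromovHyperbolic.exists_delta (X := X)
  -- Hyperbolicity is pulled back along g : X' → X; only then is the target of f known to be
  -- hyperbolic, as the product estimate for f requires.
  obtain ⟨δ', hδ', hδX'⟩ := hgqi.exists_fourPoint hδ hδX hK0.le hC₀ hgX' hgX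
  obtain ⟨A, hA⟩ := hfqi.exists_gromovProduct_le hδ' hδX' hK0.le hC₀ hgX hgX'
  obtain ⟨A', hA'⟩ := hgqi.exists_gromovProduct_le hδ hδX hK0.le hC₀ hgX' hgX
  have hfr : IsBoundaryRegular f := isBoundaryRegular_of_gromovProduct_le hK0 hA
  have hgr : IsBoundaryRegular g := isBoundaryRegular_of_gromovProduct_le hK0 hA'
  have : IsGromovHyperbolic X' := ⟨δ', hδ', hδX'⟩
  refine ⟨this, ⟨GromovBoundary.map f hfr, GromovBoundary.map g hgr,
    GromovBoundary.map_map_of_dist_le hfr hgr hgf, GromovBoundary.map_map_of_dist_le hgr hfr hfg⟩,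
    fun o o' => ⟨GromovBoundary.continuous_map hfr hgr hgf hfg o o',
      GromovBoundary.continuous_map hgr hfr hfg hgf o' o⟩,
    fun x ξ h => h.map hfr, fun a γ ξ h t ht hlim => (h t ht hlim).map hfr⟩
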